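/- Let $X$ be an infinite-dimensional complex Banach space and let $T, N$ be bounded linear operators on $X$ such that $N$ is nilpotent and $TN = NT$. Then $T$ has property $(Z_{E_a})$ if and only if $T+N$ has property $(Z_{E_a})$, and $T$ has property $(Z_{\Pi_a})$ if and only if $T+N$ has property $(Z_{\Pi_a})$. Here, for a bounded linear operator $T$ on $X$ with null space $\mathcal N(T)$, range $\mathcal R(T)$ and dual operator $T^*$: $T$ has property $(Z_{E_a})$ if $\sigma(T)\setminus\sigma_W(T)=E_a(T)$, and property $(Z_{\Pi_a})$ if $\sigma(T)\setminus\sigma_W(T)=\Pi_a(T)$, where $\sigma(T)$ is the spectrum of $T$; $\sigma_W(T)$ is the set of all $\lambda\in\mathbb C$ such that $T-\lambda I$ is not Weyl, a Weyl operator being a Fredholm operator (finite-dimensional null space and closed range of finite codimension) whose index $\dim\mathcal N(T)-\dim\mathcal N(T^*)$ is $0$; $\sigma_a(T)$ is the approximate point spectrum, i.e. the set of all $\lambda\in\mathbb C$ such that $T-\lambda I$ is not bounded below; $E_a(T)$ is the set of all isolated points of $\sigma_a(T)$ that are eigenvalues of $T$; $\Pi_a(T)$ is the set of left poles of $T$,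 i.e. of all $\lambda\in\sigma_a(T)$ such that the ascent $a=a(T-\lambda I)$ is finite and $\mathcal R((T-\lambda I)^{a+1})$ is closed, with $a(S)=\inf\{n\in\mathbb N: \mathcal N(S^n)=\mathcal N(S^{n+1})\}$ (where $0\in\mathbb N$ and $\inf\emptyset=\infty$). -/

import Mathlib

noncomputable section

namespace WeylType

variable {X : Type*} [NormedAddCommGroup X] [NormedSpace ℂ X]

/-- The operator `T - λ I`. -/
def shift (T : X →L[ℂ] X) (lam : ℂ) : X →L[ℂ] X :=
  T - lam • ContinuousLinearMap.id ℂ X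

/-- The dual operator `T*`, acting on the continuous dual of `X` by `f ↦ f ∘ T`. -/
def dualOp (T : X →L[ℂ] X) : StrongDual ℂ X →L[ℂ] StrongDual ℂ X :=
  ContinuousLinearMap.precomp ℂ T

/-- The index `dim N(T) - dim N(T*)`; only used for Fredholm operators, where both dimensions
are finite. -/
def index (T : X →L[ℂ] X) : ℤ :=
  (Module.finrank ℂ T.ker : ℤ) - (Module.finrank ℂ (dualOp T).ker : ℤ)

/-- A Weyl operator is a Fredholm operator of index `0`. -/
def IsWeyl (T : X →L[ℂ] X) : Prop :=
  T.IsFredholm ∧ index T = 0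

/-- The Weyl spectrum. -/
def weylSpectrum (T : X →L[ℂ] X) : Set ℂ :=
  {lam | ¬ IsWeyl (shift T lam)}

/-- `T` is bounded below. -/
def IsBoundedBelow (T : X →L[ℂ] X) : Prop :=
  ∃ c : ℝ, 0 < c ∧ ∀ x, c * ‖x‖ ≤ ‖T x‖

/-- The approximate point spectrum. -/
def approxPointSpectrum (T : X →L[ℂ] X) : Set ℂ :=
  {lam | ¬ IsBoundedBelow (shift T lam)}

/-- The point spectrum, i.e. the set of eigenvalues. -/
def pointSpectrum (T : X →L[ℂ] X) : Set ℂ :=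
  {lam | ∃ x : X, x ≠ 0 ∧ T x = lam • x}

/-- The isolated points of a subset of the plane. -/
def iso (A : Set ℂ) : Set ℂ :=
  {z | z ∈ A ∧ ¬ AccPt z (Filter.principal A)}

/-- The ascent: the infimum in `ℕ ∪ {∞}` of all `n` with `N(T ^ n) = N(T ^ (n + 1))`. -/
def ascent (T : X →L[ℂ] X) : ℕ∞ :=
  ⨅ (n : ℕ) (_ : (T ^ n).ker = (T ^ (n + 1)).ker), (n : ℕ∞)

/-- The set `E_a(T)` of all isolated points of the approximate point spectrum that are
eigenvalues. -/
def eigenIso (T : X →L[ℂ] X) : Set ℂ :=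
  iso (approxPointSpectrum T) ∩ pointSpectrum T

/-- The set `Π_a(T)` of left poles: the points `λ` of the approximate point spectrum such that
`T - λ I` has finite ascent `p` and `R((T - λ I) ^ (p + 1))` is closed. -/
def leftPoles (T : X →L[ℂ] X) : Set ℂ :=
  {lam | lam ∈ approxPointSpectrum T ∧
    ∃ p : ℕ, ascent (shift T lam) = (p : ℕ∞) ∧
      IsClosed (((shift T lam) ^ (p + 1)).range : Set X)}

/-- Property `(Z_{E_a})`. -/
def PropertyZE (T : X →L[ℂ] X) : Prop :=
  spectrum ℂ T \ weylSpectrum T = eigenIso T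

/-- Property `(Z_{Π_a})`. -/
def PropertyZPi (T : X →L[ℂ] X) : Prop :=
  spectrum ℂ T \ weylSpectrum T = leftPoles T

end WeylType

end

/-! Every set in the two properties is unchanged when `N` is added to `T`: the spectrum, the Weyl
spectrum, the approximate point spectrum, the eigenvalues and the left poles. It suffices that the
property of `S = T - λ` defining each set survives adding a commuting nilpotent; adding `-N` gives
the converse.

For injectivity and lower bounds, a geometric sum gives `W (S + N) = S ^ k`, so estimates for `S`
pass to `S + N`, also modulo invariant subspaces. Left poles reduce to this: up to closedness of the
subspace, finite ascent with closed range means that `S` is bounded below modulo a subspace killed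
by a power of `S`.

The Weyl property is handled by induction on the nilpotency order. On the range of `N` the order
drops, on the quotient `N` vanishes, and the snake lemma makes the index additive. Completeness
makes ranges of finite codimension closed. -/

open Function in
theorem Module.Finite.of_exact_middle {K A B C : Type*} [Field K] [AddCommGroup A] [Module K A]
    [AddCommGroup B] [Module K B] [AddCommGroup C] [Module K C] {f : A →ₗ[K] B} {g : B →ₗ[K] C}
    (h : Exact f g) [Module.Finite K A] [Module.Finite K C] : Module.Finite K B :=
  Module.Finite.of_fg_top (Submodule.fg_of_fg_map_of_fg_inf_ker g (IsNoetherian.noetherian _)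
    (by rw [top_inf_eq, h.linearMap_ker_eq, ← Submodule.map_top]
        exact Submodule.FG.map _ Module.Finite.fg_top))

theorem Submodule.mapQ_surjective {K V W : Type*} [Field K] [AddCommGroup V] [Module K V]
    [AddCommGroup W] [Module K W] {p : Submodule K V} {q : Submodule K W} {f : V →ₗ[K] W}
    (hf : Function.Surjective f) {h : p ≤ q.comap f} : Function.Surjective (p.mapQ q f h) := by
  intro y
  obtain ⟨w, rfl⟩ := q.mkQ_surjective y
  obtain ⟨v, rfl⟩ := hf w
  exact ⟨p.mkQ v, rfl⟩

/-! ### Algebraic Fredholm maps and their index. -/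

namespace LinearMap

open Function Module

/-- A linear map with finite-dimensional kernel and cokernel. -/
structure IsAlgFredholm {K V W : Type*} [Field K] [AddCommGroup V] [Module K V]
    [AddCommGroup W] [Module K W] (f : V →ₗ[K] W) : Prop where
  finite_ker : FiniteDimensional K f.ker
  finite_coker : FiniteDimensional K (W ⧸ f.range)

section Snake

variable {K V : Type*} [Field K] [AddCommGroup V] [Module K V] (A : V →ₗ[K] V) (Y : Submodule K V)
  (hY : Y ≤ Y.comap A)

/-- The long exact sequence of kernels and cokernels attached to an invariant subspace. -/
theorem exists_snake_sequence :
    ∃ (f₀ : (A.restrict hY).ker →ₗ[K] A.ker) (f₁ : A.ker →ₗ[K] (Y.mapQ Y A hY).ker)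
      (f₂ : (Y.mapQ Y A hY).ker →ₗ[K] Y ⧸ (A.restrict hY).range)
      (f₃ : (Y ⧸ (A.restrict hY).range) →ₗ[K] V ⧸ A.range)
      (f₄ : (V ⧸ A.range) →ₗ[K] (V ⧸ Y) ⧸ (Y.mapQ Y A hY).range),
      Injective f₀ ∧ Exact f₀ f₁ ∧ Exact f₁ f₂ ∧ Exact f₂ f₃ ∧ Exact f₃ f₄ ∧ Surjective f₄ := by
  have hsub : Y.subtype ∘ₗ A.restrict hY = A ∘ₗ Y.subtype := by ext; rfl
  have hmk : Y.mkQ ∘ₗ A = Y.mapQ Y A hY ∘ₗ Y.mkQ := by ext; rfl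
  have hex : Exact Y.subtype Y.mkQ := LinearMap.exact_subtype_mkQ Y
  have hker {U W : Type _} [AddCommGroup U] [Module K U] [AddCommGroup W] [Module K W]
    (B : U →ₗ[K] W) : Exact B.ker.subtype B := LinearMap.exact_subtype_ker_map B
  have hran {U W : Type _} [AddCommGroup U] [Module K U] [AddCommGroup W] [Module K W]
    (B : U →ₗ[K] W) : Exact B B.range.mkQ := LinearMap.exact_map_mkQ_range B
  let f₀ : (A.restrict hY).ker →ₗ[K] A.ker := Y.subtype.restrict fun x hx => by
    have : (A.restrict hY x : V) = 0 := by rw [LinearMap.mem_ker.1 hx]; rfl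
    exact this
  let f₁ : A.ker →ₗ[K] (Y.mapQ Y A hY).ker := Y.mkQ.restrict fun x hx => by
    simp [LinearMap.mem_ker.1 hx]
  let f₃ : (Y ⧸ (A.restrict hY).range) →ₗ[K] V ⧸ A.range :=
    Submodule.mapQ _ _ Y.subtype (by
      rintro _ ⟨x, rfl⟩
      exact ⟨x, rfl⟩)
  let f₄ : (V ⧸ A.range) →ₗ[K] (V ⧸ Y) ⧸ (Y.mapQ Y A hY).range :=
    Submodule.mapQ _ _ Y.mkQ (by
      rintro _ ⟨x, rfl⟩
      exact ⟨Y.mkQ x, rfl⟩)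
  refine ⟨f₀, f₁, SnakeLemma.δ' (A.restrict hY) A (Y.mapQ Y A hY) Y.subtype Y.mkQ hex
    Y.subtype Y.mkQ hex hsub hmk (Y.mapQ Y A hY).ker.subtype (hker _)
    (A.restrict hY).range.mkQ (hran _) (Submodule.mkQ_surjective Y) Subtype.val_injective,
    f₃, f₄, ?_, ?_, ?_, ?_, ?_, ?_⟩
  · intro x y hxy
    exact Subtype.ext (Subtype.ext congr(((($hxy : A.ker)) : V)))
  · intro x
    constructor
    · intro h
      have hx : (x : V) ∈ Y := by
        have : Y.mkQ x = 0 := congr(($h : V ⧸ Y))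
        simpa using this
      exact ⟨⟨⟨x, hx⟩, by
        rw [LinearMap.mem_ker]
        exact Subtype.ext x.2⟩, rfl⟩
    · rintro ⟨y, rfl⟩
      refine Subtype.ext ?_
      exact (Submodule.Quotient.mk_eq_zero Y).2 y.1.2
  · exact SnakeLemma.exact_δ'_right _ _ _ _ _ _ _ _ _ _ _ A.ker.subtype (hker _) _ _ _ _ _ _ f₁
      (by ext; rfl) Subtype.val_injective
  · exact SnakeLemma.exact_δ'_left _ _ _ _ _ _ _ _ _ _ _ _ _ _ _ A.range.mkQ (hran _) _ _ f₃
      (by ext; rfl) (Submodule.mkQ_surjective _)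
  · rw [LinearMap.exact_iff]
    simp only [f₃, f₄, Submodule.ker_mapQ, Submodule.range_mapQ, Submodule.range_subtype]
    rw [Submodule.comap_map_eq, Submodule.ker_mkQ, Submodule.map_sup]
    simp
  · exact Submodule.mapQ_surjective (Submodule.mkQ_surjective _)

variable {A Y}

/-- In the snake sequence the outer terms are controlled by `A` alone; the kernel on the quotient
lies between `A.ker` and the cokernel assumed finite. -/
theorem IsAlgFredholm.restrict_and_mapQ (hA : A.IsAlgFredholm)
    (hc : FiniteDimensional K (Y ⧸ (A.restrict hY).range)) :
    (A.restrict hY).IsAlgFredholm ∧ (Y.mapQ Y A hY).IsAlgFredholm := by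
  obtain ⟨f₀, f₁, f₂, f₃, f₄, h₀, h₁, h₂, h₃, h₄, h₅⟩ := exists_snake_sequence A Y hY
  have := hA.finite_ker
  have := hA.finite_coker
  exact ⟨⟨.of_injective f₀ h₀, hc⟩, ⟨.of_exact_middle h₂, .of_surjective f₄ h₅⟩⟩

theorem IsAlgFredholm.of_restrict_mapQ (h : (A.restrict hY).IsAlgFredholm)
    (h' : (Y.mapQ Y A hY).IsAlgFredholm) :
    A.IsAlgFredholm ∧ A.index = (A.restrict hY).index + (Y.mapQ Y A hY).index := by
  obtain ⟨f₀, f₁, f₂, f₃, f₄, h₀, h₁, h₂, h₃, h₄, h₅⟩ := exists_snake_sequence A Y hY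
  have := h.finite_ker
  have := h.finite_coker
  have := h'.finite_ker
  have := h'.finite_coker
  have hk : FiniteDimensional K A.ker := .of_exact_middle h₁
  have hc : FiniteDimensional K (V ⧸ A.range) := .of_exact_middle h₄
  refine ⟨⟨hk, hc⟩, ?_⟩
  have := sum_neg_one_pow_finrank_eq_zero_of_exact_six f₀ f₁ f₂ f₃ f₄ h₀ h₁ h₂ h₃ h₄ h₅
  simp only [index_eq_finrank_sub]
  linear_combination -this

end Snake

/-- A commuting nilpotent perturbation changes neither finiteness of the kernel and cokernel nor
the index. -/
theorem IsAlgFredholm.add_nilpotent {K : Type*} [Field K] (k : ℕ) {V : Type*} [AddCommGroup V]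
    [Module K V] {A N : V →ₗ[K] V} (hA : A.IsAlgFredholm) (hAN : Commute A N) (hN : N ^ k = 0) :
    (A + N).IsAlgFredholm ∧ (A + N).index = A.index := by
  induction k generalizing V with
  | zero =>
    have h1 : (1 : V →ₗ[K] V) = 0 := by simpa using hN
    have : N = 0 := by rw [← one_mul N, h1, zero_mul]
    simpa [this] using hA
  | succ k ih =>
    have hcomm (x : V) : A (N x) = N (A x) := congr($hAN.eq x)
    have hYA : N.range ≤ N.range.comap A := by
      rintro _ ⟨x, rfl⟩
      exact ⟨A x, (hcomm x).symm⟩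
    have hYN : N.range ≤ N.range.comap N := fun x _ => ⟨x, rfl⟩
    have hYAN : N.range ≤ N.range.comap (A + N) := fun x hx =>
      N.range.add_mem (hYA hx) (hYN hx)
    -- `N` commutes with `A`, so it maps the cokernel of `A` onto that of the restriction.
    have hc : FiniteDimensional K (N.range ⧸ (A.restrict hYA).range) := by
      have := hA.finite_coker
      refine .of_surjective (Submodule.mapQ A.range (A.restrict hYA).range N.rangeRestrict ?_)
        (Submodule.mapQ_surjective N.surjective_rangeRestrict)
      rintro _ ⟨x, rfl⟩
      exact ⟨⟨N x, x, rfl⟩, Subtype.ext (hcomm x)⟩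
    obtain ⟨hr, hq⟩ := hA.restrict_and_mapQ hYA hc
    have hpow (j : ℕ) (x : N.range) : ((((N.restrict hYN : N.range →ₗ[K] N.range)) ^ j) x : V) = (N ^ j) x := by
      induction j generalizing x with
      | zero => rfl
      | succ j ihj => rw [pow_succ, pow_succ]; exact ihj _
    have hnil : (N.restrict hYN : N.range →ₗ[K] N.range) ^ k = 0 := by
      ext ⟨_, x, rfl⟩
      rw [hpow]
      exact congr($hN x)
    obtain ⟨hr', hi⟩ := ih hr (by ext x; exact hcomm x) hnil
    have e1 : (A.restrict hYA + N.restrict hYN : N.range →ₗ[K] N.range) =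
        (A + N).restrict hYAN := rfl
    -- `N` induces zero modulo its own range.
    have e2 : N.range.mapQ N.range A hYA = N.range.mapQ N.range (A + N) hYAN := by
      ext x
      refine (Submodule.Quotient.eq _).2 ?_
      exact ⟨-x, by simp⟩
    rw [e1] at hr' hi
    obtain ⟨-, i1⟩ := IsAlgFredholm.of_restrict_mapQ hYA hr hq
    rw [e2] at hq i1
    obtain ⟨h, i2⟩ := IsAlgFredholm.of_restrict_mapQ hYAN hr' hq
    exact ⟨h, by rw [i1, i2, hi]⟩

end LinearMap

/-! ### Fredholm and Weyl operators on Banach spaces. -/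

open LinearMap in
/-- Between Banach spaces, an operator with finite-dimensional kernel and cokernel is Fredholm. -/
theorem ContinuousLinearMap.isFredholm_iff_isAlgFredholm {X Y : Type*} [NormedAddCommGroup X]
    [NormedSpace ℂ X] [CompleteSpace X] [NormedAddCommGroup Y] [NormedSpace ℂ Y] [CompleteSpace Y]
    (S : X →L[ℂ] Y) : S.IsFredholm ↔ (S : X →ₗ[ℂ] Y).IsAlgFredholm := by
  refine ⟨fun h => ⟨h.finite_ker, h.finite_coker⟩, fun h => ?_⟩
  have := h.finite_ker
  have := h.finite_coker
  have hk : S.ker.ClosedComplemented := .of_finiteDimensional S.ker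
  obtain ⟨E, hE⟩ := hk.exists_isTopCompl
  have hEc : IsClosed (E : Set X) := hE.symm.isClosed
  have : CompleteSpace E := hEc.completeSpace_coe
  -- Restricting to a closed complement of the kernel gives an injective operator with the same
  -- range, and a complemented range is then closed.
  let R : E →L[ℂ] Y := S ∘L E.subtypeL
  have hR : R.range = S.range := by
    apply le_antisymm
    · rintro _ ⟨x, rfl⟩
      exact ⟨x, rfl⟩
    · rintro _ ⟨x, rfl⟩
      obtain ⟨u, hu, v, hv, rfl⟩ := Submodule.mem_sup.1
        (show x ∈ S.ker ⊔ E by rw [hE.isCompl.sup_eq_top]; trivial)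
      exact ⟨⟨v, hv⟩, by simpa [R] using hu⟩
  have hRk : R.ker = ⊥ := by
    refine LinearMap.ker_eq_bot'.2 fun x hx => ?_
    exact Subtype.ext (Submodule.disjoint_def.1 hE.isCompl.disjoint x hx x.2)
  have hcl : IsClosed (S.range : Set Y) := by
    obtain ⟨G, hG⟩ := Submodule.exists_isCompl S.range
    have : FiniteDimensional ℂ G := .of_fg (Submodule.CoFG.fg_of_isCompl hG h.finite_coker)
    rw [← hR] at hG ⊢
    exact R.closed_complemented_range_of_isCompl_of_ker_eq_bot G hG
      G.closed_of_finiteDimensional hRk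
  have : CompleteSpace S.range := hcl.completeSpace_coe
  refine ⟨?_, hcl, h.finite_ker, h.finite_coker, hk⟩
  have hs : Function.Surjective S.rangeRestrict := LinearMap.surjective_rangeRestrict _
  refine (LinearMap.isStrictMap_iff_isOpenQuotientMap_rangeRestrict (f := (S : X →ₗ[ℂ] Y))).2 ?_
  exact ⟨hs, S.rangeRestrict.continuous, S.rangeRestrict.isOpenMap hs⟩

namespace WeylType

variable {X : Type*} [NormedAddCommGroup X] [NormedSpace ℂ X]

/-- The kernel of the dual operator is the dual of the cokernel, when the range is closed and of
finite codimension. -/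
theorem finrank_ker_dualOp {S : X →L[ℂ] X} (hS : S.IsFredholm) :
    Module.finrank ℂ (dualOp S).ker = Module.finrank ℂ (X ⧸ S.range) := by
  have := hS.finite_coker
  have := hS.isClosed_range
  let F : Module.Dual ℂ (X ⧸ S.range) →ₗ[ℂ] (dualOp S).ker :=
    { toFun := fun φ => ⟨(LinearMap.toContinuousLinearMap φ) ∘L S.range.mkQL, by
        rw [LinearMap.mem_ker]
        ext x
        have : (Submodule.Quotient.mk (S x) : X ⧸ S.range) = 0 :=
          (Submodule.Quotient.mk_eq_zero _).2 ⟨x, rfl⟩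
        simp [dualOp, this]⟩
      map_add' := fun _ _ => rfl
      map_smul' := fun _ _ => rfl }
  have hF : Function.Bijective F := by
    constructor
    · intro φ ψ h
      ext x
      exact congr(($h : StrongDual ℂ X) x)
    · rintro ⟨f, hf⟩
      refine ⟨S.range.liftQ (f : X →ₗ[ℂ] ℂ) ?_, ?_⟩
      · rintro _ ⟨x, rfl⟩
        exact congr($hf x)
      · ext x
        rfl
  rw [← (LinearEquiv.ofBijective F hF).finrank_eq, Subspace.dual_finrank_eq]

theorem index_eq_linearMap_index {S : X →L[ℂ] X} (hS : S.IsFredholm) :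
    index S = (S : X →ₗ[ℂ] X).index := by
  rw [index, finrank_ker_dualOp hS, LinearMap.index_eq_finrank_sub]

theorem IsWeyl.add_nilpotent [CompleteSpace X] {S N : X →L[ℂ] X} (hS : IsWeyl S)
    (hN : IsNilpotent N) (hc : Commute S N) : IsWeyl (S + N) := by
  obtain ⟨k, hk⟩ := hN
  have hpow (j : ℕ) : ((N ^ j : X →L[ℂ] X) : X →ₗ[ℂ] X) = (N : X →ₗ[ℂ] X) ^ j := by
    induction j with
    | zero => rfl
    | succ j ih => rw [pow_succ, pow_succ, ← ih]; rfl
  obtain ⟨h1, h2⟩ := ((S.isFredholm_iff_isAlgFredholm).1 hS.1).add_nilpotent k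
    (N := (N : X →ₗ[ℂ] X)) (by ext x; exact congr($hc.eq x)) (by rw [← hpow, hk]; rfl)
  have hF : (S + N).IsFredholm := ((S + N).isFredholm_iff_isAlgFredholm).2 h1
  refine ⟨hF, ?_⟩
  rw [index_eq_linearMap_index hF, ← hS.2, index_eq_linearMap_index hS.1]
  exact h2

end WeylType

/-! ### Lower bounds modulo a subspace. -/

namespace WeylType

variable {X : Type*} [NormedAddCommGroup X] [NormedSpace ℂ X]

/-- If `N` is nilpotent and commutes with `S`, then `S + N` right-divides a power of `S`. -/
theorem exists_mul_add_eq_pow {R : Type*} [Ring R] {S N : R} (hN : IsNilpotent N)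
    (hc : Commute S N) : ∃ (k : ℕ) (W : R), W * (S + N) = S ^ k ∧
      ∀ B, Commute B S → Commute B N → Commute B W := by
  obtain ⟨k, hk⟩ := hN
  -- Telescoping gives `S ^ k - (-N) ^ k`, whose last term vanishes.
  refine ⟨k, ∑ i ∈ Finset.range k, S ^ i * (-N) ^ (k - 1 - i), ?_, fun B hS hN' => ?_⟩
  · have := hc.neg_right.geom_sum₂_mul k
    rwa [sub_neg_eq_add, neg_pow, hk, mul_zero, sub_zero] at this
  · exact Commute.sum_right _ _ _ fun i _ =>
      (hS.pow_right i).mul_right (hN'.neg_right.pow_right _)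

theorem le_pow_of_boundedBelow {α : Type*} (q : α → ℝ) {f : α → α} {c : ℝ} (hc : 0 ≤ c)
    (hf : ∀ x, c * q x ≤ q (f x)) (n : ℕ) (x : α) : c ^ n * q x ≤ q (f^[n] x) := by
  induction n generalizing x with
  | zero => simp
  | succ n ih =>
    rw [Function.iterate_succ_apply, pow_succ, mul_assoc]
    exact (mul_le_mul_of_nonneg_left (hf x) (pow_nonneg hc n)).trans (ih _)

/-- The quotient norm decreases by at most the operator norm under an operator leaving the
subspace invariant. -/
theorem norm_mk_apply_le {A : X →L[ℂ] X} {Z Z' : Submodule ℂ X} (hA : ∀ z ∈ Z, A z ∈ Z') (x : X) :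
    ‖(Submodule.Quotient.mk (A x) : X ⧸ Z')‖ ≤ ‖A‖ * ‖(Submodule.Quotient.mk x : X ⧸ Z)‖ := by
  refine le_of_forall_pos_le_add fun ε hε => ?_
  have hd : 0 < ‖A‖ + 1 := by positivity
  obtain ⟨m, hm, hlt⟩ := Submodule.Quotient.norm_mk_lt (Submodule.Quotient.mk x : X ⧸ Z)
    (div_pos hε hd)
  have : (Submodule.Quotient.mk (A x) : X ⧸ Z') = Submodule.Quotient.mk (A m) := by
    rw [eq_comm, Submodule.Quotient.eq, ← map_sub]
    exact hA _ ((Submodule.Quotient.eq _).1 hm)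
  rw [this]
  calc _ ≤ ‖A m‖ := Submodule.Quotient.norm_mk_le _ _
    _ ≤ ‖A‖ * ‖m‖ := A.le_opNorm m
    _ ≤ ‖A‖ * (‖(Submodule.Quotient.mk x : X ⧸ Z)‖ + ε / (‖A‖ + 1)) := by gcongr
    _ ≤ _ := by
      rw [mul_add]
      gcongr
      rw [mul_div_assoc', div_le_iff₀ hd]
      nlinarith [norm_nonneg A]

/-- `S` induces a bounded below operator on the quotient by `Z`. -/
def BoundedBelowMod (S : X →L[ℂ] X) (Z : Submodule ℂ X) : Prop :=
  ∃ c : ℝ, 0 < c ∧ ∀ x, c * ‖(Submodule.Quotient.mk x : X ⧸ Z)‖ ≤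
    ‖(Submodule.Quotient.mk (S x) : X ⧸ Z)‖

/-- Modulo `Z`, `c ^ k * ‖x‖ ≤ ‖S ^ k x‖ = ‖W (S + N) x‖ ≤ ‖W‖ * ‖(S + N) x‖`; `hZ` is what lets `W`
act on the quotient. -/
theorem BoundedBelowMod.add_nilpotent {S N : X →L[ℂ] X} {Z : Submodule ℂ X}
    (h : BoundedBelowMod S Z) (hN : IsNilpotent N) (hc : Commute S N)
    (hZ : ∀ B : X →L[ℂ] X, Commute B S → Commute B N → ∀ z ∈ Z, B z ∈ Z) :
    BoundedBelowMod (S + N) Z := by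
  obtain ⟨c, hc0, hS⟩ := h
  obtain ⟨k, W, hW, hWc⟩ := exists_mul_add_eq_pow hN hc
  have hWZ := hZ W (hWc S (.refl S) hc).symm (hWc N hc.symm (.refl N)).symm
  have hd : 0 < ‖W‖ + 1 := by positivity
  refine ⟨c ^ k / (‖W‖ + 1), by positivity, fun x => ?_⟩
  have h1 := le_pow_of_boundedBelow (fun x => ‖(Submodule.Quotient.mk x : X ⧸ Z)‖) hc0.le hS k x
  have h2 : S^[k] x = W ((S + N) x) := by
    rw [← FunLike.coe_pow_eq_iterate, ← hW]
    rfl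
  rw [h2] at h1
  rw [div_mul_eq_mul_div, div_le_iff₀ hd]
  have h3 := norm_mk_apply_le hWZ ((S + N) x)
  have h4 := norm_nonneg (Submodule.Quotient.mk ((S + N) x) : X ⧸ Z)
  linarith

theorem norm_mk_bot (x : X) :
    ‖(Submodule.Quotient.mk x : X ⧸ (⊥ : Submodule ℂ X))‖ = ‖x‖ := by
  refine le_antisymm (Submodule.Quotient.norm_mk_le _ _) ?_
  refine le_of_forall_pos_le_add fun ε hε => ?_
  obtain ⟨m, hm, hlt⟩ := Submodule.Quotient.norm_mk_lt
    (Submodule.Quotient.mk x : X ⧸ (⊥ : Submodule ℂ X)) hε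
  rw [Submodule.Quotient.eq, Submodule.mem_bot, sub_eq_zero] at hm
  exact hm ▸ hlt.le

theorem isBoundedBelow_iff_mod_bot {S : X →L[ℂ] X} : IsBoundedBelow S ↔ BoundedBelowMod S ⊥ := by
  simp only [IsBoundedBelow, BoundedBelowMod, norm_mk_bot]

theorem IsBoundedBelow.add_nilpotent {S N : X →L[ℂ] X} (h : IsBoundedBelow S)
    (hN : IsNilpotent N) (hc : Commute S N) : IsBoundedBelow (S + N) := by
  rw [isBoundedBelow_iff_mod_bot] at h ⊢
  refine h.add_nilpotent hN hc fun B _ _ z hz => ?_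
  rw [Submodule.mem_bot] at hz ⊢
  rw [hz, map_zero]

theorem ker_add_nilpotent_eq_bot {S N : X →L[ℂ] X} (h : S.ker = ⊥)
    (hN : IsNilpotent N) (hc : Commute S N) : (S + N).ker = ⊥ := by
  obtain ⟨k, W, hW, -⟩ := exists_mul_add_eq_pow hN hc
  refine LinearMap.ker_eq_bot'.2 fun x hx => ?_
  have h1 : (S ^ k) x = 0 := by
    rw [← hW]
    exact (congrArg W hx).trans (map_zero W)
  rw [FunLike.coe_pow_eq_iterate] at h1
  have h2 : Function.Injective S := LinearMap.ker_eq_bot.1 h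
  exact (h2.iterate k) (h1.trans (Function.iterate_fixed (map_zero S) k).symm)

/-- Closedness of the range as a lower bound modulo the kernel. -/
theorem isClosed_range_iff_bound [CompleteSpace X] {A : X →L[ℂ] X} :
    IsClosed (A.range : Set X) ↔
      ∃ c : ℝ, 0 < c ∧ ∀ x, c * ‖(Submodule.Quotient.mk x : X ⧸ A.ker)‖ ≤ ‖A x‖ := by
  constructor
  · intro h
    have : CompleteSpace A.range := h.completeSpace_coe
    obtain ⟨C, hC, hA⟩ := A.rangeRestrict.exists_preimage_norm_le
      (LinearMap.surjective_rangeRestrict _)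
    refine ⟨C⁻¹, inv_pos.2 hC, fun x => ?_⟩
    obtain ⟨y, hy, hle⟩ := hA ⟨A x, x, rfl⟩
    have hy' : A y = A x := congr(($hy : X))
    have : (Submodule.Quotient.mk x : X ⧸ A.ker) = Submodule.Quotient.mk y := by
      rw [Submodule.Quotient.eq, LinearMap.mem_ker]
      simp [hy']
    rw [this, inv_mul_le_iff₀ hC]
    exact (Submodule.Quotient.norm_mk_le _ _).trans hle
  · rintro ⟨c, hc, h⟩
    have : IsClosed (A.ker : Set X) := A.isClosed_ker
    let L : (X ⧸ A.ker) →L[ℂ] X := A.ker.liftQL A le_rfl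
    have hL : AntilipschitzWith (Real.toNNReal c⁻¹) L := by
      refine L.antilipschitz_of_bound fun y => ?_
      obtain ⟨x, rfl⟩ := A.ker.mkQ_surjective y
      rw [Real.coe_toNNReal _ (inv_pos.2 hc).le, ← div_eq_inv_mul, le_div_iff₀' hc]
      exact h x
    have hr : (A.range : Set X) = Set.range L := by
      ext y
      constructor
      · rintro ⟨x, rfl⟩
        exact ⟨A.ker.mkQ x, rfl⟩
      · rintro ⟨z, rfl⟩
        obtain ⟨x, rfl⟩ := A.ker.mkQ_surjective z
        exact ⟨x, rfl⟩
    rw [hr]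
    exact hL.isClosed_range L.uniformContinuous

/-! ### Ascent and left poles. -/

theorem ker_pow_mono (S : X →L[ℂ] X) {m n : ℕ} (h : m ≤ n) : (S ^ m).ker ≤ (S ^ n).ker := by
  intro x hx
  rw [LinearMap.mem_ker] at hx ⊢
  have : S ^ n = S ^ (n - m) * S ^ m := by rw [← pow_add, Nat.sub_add_cancel h]
  rw [this]
  exact (congrArg (S ^ (n - m) : X →L[ℂ] X) hx).trans (map_zero _)

theorem ker_pow_eq_of_le {S : X →L[ℂ] X} {p : ℕ} (hp : (S ^ p).ker = (S ^ (p + 1)).ker) {n : ℕ}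
    (h : p ≤ n) : (S ^ n).ker = (S ^ p).ker := by
  induction n, h using Nat.le_induction with
  | base => rfl
  | succ n h ih =>
    refine le_antisymm (fun x hx => ?_) (ker_pow_mono S (by omega))
    have h1 : S x ∈ (S ^ n).ker := by
      rw [LinearMap.mem_ker] at hx ⊢
      rw [pow_succ] at hx
      exact hx
    rw [ih] at h1
    rw [hp, LinearMap.mem_ker, pow_succ]
    exact h1

theorem ascent_eq_coe {S : X →L[ℂ] X} {p : ℕ} (h : ascent S = p) :
    (S ^ p).ker = (S ^ (p + 1)).ker := by
  by_contra hne
  have : ((p + 1 : ℕ) : ℕ∞) ≤ ascent S := by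
    refine le_iInf₂ fun n hn => ?_
    by_contra! hlt
    have hnp : n ≤ p := by
      have : n < p + 1 := by exact_mod_cast hlt
      omega
    exact hne ((ker_pow_eq_of_le hn hnp).trans (ker_pow_eq_of_le hn (by omega)).symm)
  rw [h] at this
  have : p + 1 ≤ p := by exact_mod_cast this
  omega

theorem exists_ascent_eq_coe {S : X →L[ℂ] X} {n : ℕ} (h : (S ^ n).ker = (S ^ (n + 1)).ker) :
    ∃ p ≤ n, ascent S = (p : ℕ∞) := by
  have hle : ascent S ≤ n := iInf₂_le n h
  obtain ⟨p, hp⟩ := ENat.ne_top_iff_exists.1 (ne_top_of_le_ne_top (ENat.natCast_ne_top n) hle)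
  exact ⟨p, by rw [← hp] at hle; exact_mod_cast hle, hp.symm⟩

/-- Finite ascent `p` together with closedness of the range of the power `p + 1`. -/
def IsLeftDrazin (S : X →L[ℂ] X) : Prop :=
  ∃ p : ℕ, ascent S = (p : ℕ∞) ∧ IsClosed ((S ^ (p + 1)).range : Set X)

theorem IsLeftDrazin.exists_boundedBelowMod [CompleteSpace X] {S : X →L[ℂ] X}
    (h : IsLeftDrazin S) : ∃ p, BoundedBelowMod S (S ^ p).ker := by
  obtain ⟨p, hp, hcl⟩ := h
  have hk := ascent_eq_coe hp
  obtain ⟨c, hc, hb⟩ := isClosed_range_iff_bound.1 hcl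
  rw [← hk] at hb
  have hd : 0 < ‖S ^ p‖ + 1 := by positivity
  refine ⟨p, c / (‖S ^ p‖ + 1), by positivity, fun x => ?_⟩
  -- `S ^ p` factors through the quotient by its kernel, so `‖S ^ (p + 1) x‖` is at most `‖S ^ p‖`
  -- times the quotient norm of `S x`.
  have h1 := norm_mk_apply_le (A := S ^ p) (Z := (S ^ p).ker) (Z' := ⊥)
    (fun z hz => (Submodule.mem_bot ℂ).2 hz) (S x)
  have h2 := hb x
  have h3 := norm_nonneg (Submodule.Quotient.mk (S x) : X ⧸ (S ^ p).ker)
  rw [norm_mk_bot] at h1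
  rw [pow_succ, show (S ^ p * S) x = (S ^ p) (S x) from rfl] at h2
  rw [div_mul_eq_mul_div, div_le_iff₀ hd]
  linarith

/-- Iterating the bound gives `c ^ m * ‖x mod Z‖ ≤ ‖S ^ m x‖`. This forces every `(S ^ m).ker` into
`Z`, so the kernels stabilise at `Z`, and it is then the closed range criterion. -/
theorem isLeftDrazin_of_boundedBelowMod [CompleteSpace X] {S : X →L[ℂ] X} {Z : Submodule ℂ X}
    (hZ : IsClosed (Z : Set X)) {n : ℕ} (hn : Z ≤ (S ^ n).ker) (h : BoundedBelowMod S Z) :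
    IsLeftDrazin S := by
  obtain ⟨c, hc, hS⟩ := h
  have hpow (m : ℕ) (x : X) : c ^ m * ‖(Submodule.Quotient.mk x : X ⧸ Z)‖ ≤ ‖(S ^ m) x‖ := by
    rw [FunLike.coe_pow_eq_iterate]
    exact (le_pow_of_boundedBelow (fun x => ‖(Submodule.Quotient.mk x : X ⧸ Z)‖) hc.le hS m x).trans
      (Submodule.Quotient.norm_mk_le _ _)
  have hker (m : ℕ) : (S ^ m).ker ≤ Z := by
    intro x hx
    have h1 := hpow m x
    rw [show (S ^ m) x = 0 from hx, norm_zero] at h1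
    have h2 : ‖(Submodule.Quotient.mk x : X ⧸ Z)‖ = 0 :=
      le_antisymm (nonpos_of_mul_nonpos_right h1 (pow_pos hc m)) (norm_nonneg _)
    exact (Submodule.Quotient.mk_eq_zero Z).1 (norm_eq_zero.1 h2)
  have hZn : (S ^ n).ker = Z := le_antisymm (hker n) hn
  obtain ⟨p, hpn, hp⟩ := exists_ascent_eq_coe
    (hZn.trans (le_antisymm (hn.trans (ker_pow_mono S n.le_succ)) (hker _)))
  have hk := ascent_eq_coe hp
  have hZp : (S ^ (p + 1)).ker = Z := by rw [← hk, ← ker_pow_eq_of_le hk hpn, hZn]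
  refine ⟨p, hp, isClosed_range_iff_bound.2 ⟨c ^ (p + 1), pow_pos hc _, fun x => ?_⟩⟩
  rw [hZp]
  exact hpow _ x

theorem IsLeftDrazin.add_nilpotent [CompleteSpace X] {S N : X →L[ℂ] X} (h : IsLeftDrazin S)
    (hN : IsNilpotent N) (hc : Commute S N) : IsLeftDrazin (S + N) := by
  obtain ⟨p, hp⟩ := h.exists_boundedBelowMod
  have hinv (B : X →L[ℂ] X) (hB : Commute B S) (x : X) (hx : x ∈ (S ^ p).ker) :
      B x ∈ (S ^ p).ker := by
    rw [LinearMap.mem_ker] at hx ⊢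
    exact congr($((hB.pow_right p).symm.eq) x).trans ((congrArg B hx).trans (map_zero B))
  -- With the roles exchanged, `W * S = (S + N) ^ k`; hence `(S + N) ^ (k * p) = W ^ p * S ^ p`
  -- kills `(S ^ p).ker`.
  obtain ⟨k, W, hW, hWc⟩ := exists_mul_add_eq_pow (S := S + N) (N := -N) hN.neg
    ((hc.add_left (.refl N)).neg_right)
  have hWS : Commute W S := by
    refine (hWc S ?_ hc.neg_right).symm
    exact (Commute.refl S).add_right hc
  refine isLeftDrazin_of_boundedBelowMod (n := k * p) (S ^ p).isClosed_ker ?_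
    (hp.add_nilpotent hN hc fun B hB _ => hinv B hB)
  intro x hx
  rw [LinearMap.mem_ker] at hx ⊢
  rw [pow_mul, ← hW, add_neg_cancel_right, hWS.mul_pow]
  exact (congrArg (W ^ p : X →L[ℂ] X) hx).trans (map_zero _)

/-! ### Invariance of the spectral sets. -/

theorem shift_add (T N : X →L[ℂ] X) (lam : ℂ) : shift (T + N) lam = shift T lam + N := by
  rw [shift, shift, add_sub_right_comm]

theorem commute_shift {T N : X →L[ℂ] X} (h : Commute T N) (lam : ℂ) : Commute (shift T lam) N :=
  h.sub_left ((Commute.one_left N).smul_left lam)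

/-- A property of operators stable under commuting nilpotent perturbations holds for `T - λ` if and
only if it holds for `T + N - λ`. -/
theorem shift_add_nilpotent_iff {P : (X →L[ℂ] X) → Prop}
    (hP : ∀ {S N : X →L[ℂ] X}, P S → IsNilpotent N → Commute S N → P (S + N))
    {T N : X →L[ℂ] X} (hN : IsNilpotent N) (hc : Commute T N) (lam : ℂ) :
    P (shift (T + N) lam) ↔ P (shift T lam) := by
  rw [shift_add]
  refine ⟨fun h => ?_, fun h => hP h hN (commute_shift hc lam)⟩
  have := hP h hN.neg (((commute_shift hc lam).add_left (.refl N)).neg_right)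
  rwa [add_neg_cancel_right] at this

theorem spectrum_eq_setOf_shift (T : X →L[ℂ] X) :
    spectrum ℂ T = {lam | ¬ IsUnit (shift T lam)} := by
  ext lam
  rw [spectrum.mem_iff, ← IsUnit.neg_iff, neg_sub]
  rfl

theorem pointSpectrum_eq_setOf_shift (T : X →L[ℂ] X) :
    pointSpectrum T = {lam | ¬ (shift T lam).ker = ⊥} := by
  ext lam
  have (x : X) : x ∈ (shift T lam).ker ↔ T x = lam • x := by
    rw [LinearMap.mem_ker, ← sub_eq_zero (a := T x)]
    rfl
  simp only [pointSpectrum, Set.mem_ofPred_eq, Submodule.eq_bot_iff, this]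
  push Not
  exact exists_congr fun x => and_comm

variable {T N : X →L[ℂ] X}

theorem spectrum_add_nilpotent (hN : IsNilpotent N) (hc : Commute T N) :
    spectrum ℂ (T + N) = spectrum ℂ T := by
  simp only [spectrum_eq_setOf_shift, shift_add_nilpotent_iff (P := IsUnit)
    (fun h hN hc => hN.isUnit_add_left_of_commute h hc.symm) hN hc]

theorem weylSpectrum_add_nilpotent [CompleteSpace X] (hN : IsNilpotent N) (hc : Commute T N) :
    weylSpectrum (T + N) = weylSpectrum T := by
  simp only [weylSpectrum, shift_add_nilpotent_iff IsWeyl.add_nilpotent hN hc]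

theorem approxPointSpectrum_add_nilpotent (hN : IsNilpotent N) (hc : Commute T N) :
    approxPointSpectrum (T + N) = approxPointSpectrum T := by
  simp only [approxPointSpectrum, shift_add_nilpotent_iff IsBoundedBelow.add_nilpotent hN hc]

theorem pointSpectrum_add_nilpotent (hN : IsNilpotent N) (hc : Commute T N) :
    pointSpectrum (T + N) = pointSpectrum T := by
  simp only [pointSpectrum_eq_setOf_shift,
    shift_add_nilpotent_iff (P := fun S => S.ker = ⊥) ker_add_nilpotent_eq_bot hN hc]

theorem leftPoles_add_nilpotent [CompleteSpace X] (hN : IsNilpotent N) (hc : Commute T N) :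
    leftPoles (T + N) = leftPoles T := by
  ext lam
  exact and_congr (by rw [approxPointSpectrum_add_nilpotent hN hc])
    (shift_add_nilpotent_iff IsLeftDrazin.add_nilpotent hN hc lam)

end WeylType

theorem mainTheorem7 {X : Type*} [NormedAddCommGroup X] [NormedSpace ℂ X] [CompleteSpace X]
    (hX : ¬ FiniteDimensional ℂ X) (T N : X →L[ℂ] X) (hN : IsNilpotent N) (hTN : Commute N T) :
    (WeylType.PropertyZE T ↔ WeylType.PropertyZE (T + N)) ∧
      (WeylType.PropertyZPi T ↔ WeylType.PropertyZPi (T + N)) := by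
  have hc := hTN.symm
  simp only [WeylType.PropertyZE, WeylType.PropertyZPi, WeylType.eigenIso,
    WeylType.spectrum_add_nilpotent hN hc, WeylType.weylSpectrum_add_nilpotent hN hc,
    WeylType.approxPointSpectrum_add_nilpotent hN hc,
    WeylType.pointSpectrum_add_nilpotent hN hc, WeylType.leftPoles_add_nilpotent hN hc,
    and_self]
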